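/- Let $(\mathcal X,\mathcal A,P)$ be a probability space and let $\mathscr C\subset\mathcal A$ be a countable collection of measurable sets. For $\epsilon>0$ let $\mathcal N_I(\epsilon,\mathscr C,P)$ be the $\epsilon$-bracketing number of $\{\mathbf 1_C: C\in\mathscr C\}$ in $L_1(P)$, i.e. the least number of brackets $[\ell,u]=\{f:\ell\le f\le u\}$ with $\ell\le u$ in $L_1(P)$ and $\|u-\ell\|_{L_1(P)}<\epsilon$ whose union contains $\{\mathbf 1_C: C\in\mathscr C\}$. Let $X_1,\dots,X_n$ ($n\ge 1$) be i.i.d. with law $P$, let $\xi_1,\dots,\xi_n$ be i.i.d. $\mathcal N(0,1)$ and independent of $(X_1,\dots,X_n)$, and for $C_0\in\mathscr C$ let $$Y_i=\mathbf 1_{C_0}(X_i)+\xi_i,\qquad i=1,\dots,n.$$ Let $\widehat C_n$ be a least squares estimator over $\mathscr C$, i.e. $\widehat C_n\in\arg\min_{C\in\mathscr C}\sum_{i=1}^n (Y_i-\mathbf 1_C(X_i))^2$. Theorem. Let $\alpha>0$, $\alpha\ne 1$, and $L>0$. There is a constant $K>0$ depending only on $\alpha$ and $L$ such that, whenever $$\log\mathcal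 N_I(\epsilon,\mathscr C,P)\le L\epsilon^{-\alpha}\qquad\text{for all }0<\epsilon\le 1,$$ then for every $n\ge 1$ $$\sup_{C_0\in\mathscr C}\ \mathbb E_{C_0}\,P\big(\widehat C_n\,\Delta\, C_0\big)\le K\,n^{-1/(\alpha+1)},$$ where $\mathbb E_{C_0}$ is the expectation when the true set is $C_0$, and $P(\widehat C_n\Delta C_0)=\int(\mathbf 1_{\widehat C_n}-\mathbf 1_{C_0})^2\,dP$. -/

import Mathlib

open MeasureTheory ProbabilityTheory

universe u v

noncomputable section

namespace ImageEstimation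

/-- `[ℓ, u]` is an `ε`-bracket in `L₁(P)`: `ℓ ≤ u` are `P`-integrable and `‖u - ℓ‖_{L₁(P)} < ε`. -/
def IsL1Bracket {𝒳 : Type u} [MeasurableSpace 𝒳] (P : Measure 𝒳) (ε : ℝ)
    (b : (𝒳 → ℝ) × (𝒳 → ℝ)) : Prop :=
  Integrable b.1 P ∧ Integrable b.2 P ∧ b.1 ≤ b.2 ∧ ∫ x, |b.2 x - b.1 x| ∂P < ε

/-- The bracketing number `N_[](ε, ℱ, L₁(P))`: the least number of `ε`-brackets in `L₁(P)` such
that every `f ∈ ℱ` satisfies `ℓ ≤ f ≤ u` for one of them (`⊤` if no finite number suffices). -/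
def bracketingNumber {𝒳 : Type u} [MeasurableSpace 𝒳] (P : Measure 𝒳) (ε : ℝ)
    (ℱ : Set (𝒳 → ℝ)) : ℕ∞ :=
  ⨅ B : {B : Finset ((𝒳 → ℝ) × (𝒳 → ℝ)) //
      (∀ b ∈ B, IsL1Bracket P ε b) ∧ ∀ f ∈ ℱ, ∃ b ∈ B, b.1 ≤ f ∧ f ≤ b.2},
    (B.1.card : ℕ∞)

/-- The bracketing number `N_I(ε, 𝒞, P)` of a class of sets: the `L₁(P)` bracketing number of the
class of indicator functions `{1_C : C ∈ 𝒞}`. -/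
def setBracketingNumber {𝒳 : Type u} [MeasurableSpace 𝒳] (P : Measure 𝒳) (ε : ℝ)
    (𝒞 : Set (Set 𝒳)) : ℕ∞ :=
  bracketingNumber P ε ((fun C : Set 𝒳 => C.indicator (fun _ => (1 : ℝ))) '' 𝒞)

/-- Design points `X₁, …, Xₙ` i.i.d. with law `P`, and errors `ξ₁, …, ξₙ` i.i.d. `N(0,1)`,
the errors being independent of the design points. -/
structure IsDesignWithGaussianNoise {𝒳 : Type u} [MeasurableSpace 𝒳] (P : Measure 𝒳)
    {Ω : Type v} [MeasurableSpace Ω] (μ : Measure Ω) {n : ℕ}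
    (X : Fin n → Ω → 𝒳) (ξ : Fin n → Ω → ℝ) : Prop where
  measurable_X : ∀ i, Measurable (X i)
  measurable_ξ : ∀ i, Measurable (ξ i)
  law_X : ∀ i, μ.map (X i) = P
  law_ξ : ∀ i, μ.map (ξ i) = gaussianReal 0 1
  iIndepFun_X : iIndepFun X μ
  iIndepFun_ξ : iIndepFun ξ μ
  indepFun_X_ξ : IndepFun (fun ω i => X i ω) (fun ω i => ξ i ω) μ

/-- The responses `Yᵢ = 1_{C₀}(Xᵢ) + ξᵢ` of the image estimation model with true image `C₀`. -/
def response {𝒳 : Type u} {Ω : Type v} {n : ℕ} (C₀ : Set 𝒳)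
    (X : Fin n → Ω → 𝒳) (ξ : Fin n → Ω → ℝ) (i : Fin n) (ω : Ω) : ℝ :=
  C₀.indicator (fun _ => (1 : ℝ)) (X i ω) + ξ i ω

/-- The least squares criterion `∑ᵢ (yᵢ - 1_C(xᵢ))²`. -/
def leastSquares {𝒳 : Type u} {n : ℕ} (x : Fin n → 𝒳) (y : Fin n → ℝ) (C : Set 𝒳) : ℝ :=
  ∑ i, (y i - C.indicator (fun _ => (1 : ℝ)) (x i)) ^ 2

/-- `C` is a global least squares fit over `𝒞` to the data `(x₁, y₁), …, (xₙ, yₙ)`. -/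
def IsLeastSquaresFit {𝒳 : Type u} {n : ℕ} (𝒞 : Set (Set 𝒳)) (x : Fin n → 𝒳) (y : Fin n → ℝ)
    (C : Set 𝒳) : Prop :=
  C ∈ 𝒞 ∧ ∀ C' ∈ 𝒞, leastSquares x y C ≤ leastSquares x y C'

end ImageEstimation

end

noncomputable section

namespace ImageEstimation

/-! A union bound over brackets at a single scale `δ` suffices; no chaining is needed. For
indicators the squared loss equals the `L₁` distance, so in the Gaussian moment generating function
the variance of the noise term is of the order of the loss plus the bracket width, and a small
enough multiple of the gain has its noise beaten by the negative drift `-bracketLoss`.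

Over `n` observations this gives `E exp(S_b / 12) ≤ exp(n (2δ - D_b / 64))`, with `S_b` the summed
gain bound and `D_b` the mean loss of bracket `b` (`lintegral_exp_bracketGain_le`,
`lintegral_exp_sum_bracketGain_le`). A bracket around the least squares fit has `S_b ≥ 0`, so
summing over `exp(n H)` brackets bounds the risk by a multiple of `H + δ + 1/n`
(`lintegral_measure_symmDiff_le`). Balancing the entropy `L δ^(-α)` against `n δ` gives `δ =
n^(-1/(α+1))`. -/

/-! ### Pointwise comparison of gain, loss and brackets -/

/-- For a bracket `[l, u]` of `1_C` and `g = 1_{C₀}`, a pointwise lower bound of `1_{C Δ C₀}`. -/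
def bracketLoss (l u g : ℝ) : ℝ := g * (1 - u) + (1 - g) * l

/-- For a bracket `[l, u]` of `1_C` and `g = 1_{C₀}`, a pointwise upper bound of the gain
`s² - (g + s - 1_C)²` in the least squares criterion when `C₀` is replaced by `C`. -/
def bracketGain (l u g s : ℝ) : ℝ :=
  2 * s * (l - g) + 2 * max s 0 * (u - l) - bracketLoss l u g

/-- The left side is `2 s (c - g) - (c - g)²`; split `c - g = (l - g) + (c - l)` and bound `s (c -
l)` by its positive part times the width. -/
lemma sq_sub_sq_le_bracketGain {l u g c : ℝ} (s : ℝ) (hg : g = 0 ∨ g = 1) (hc : c = 0 ∨ c = 1)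
    (hl : l ≤ c) (hu : c ≤ u) :
    s ^ 2 - (g + s - c) ^ 2 ≤ bracketGain l u g s := by
  have h₁ : s * (c - l) ≤ max s 0 * (u - l) :=
    (mul_le_mul_of_nonneg_right (le_max_left s 0) (by linarith)).trans
      (mul_le_mul_of_nonneg_left (by linarith) (le_max_right s 0))
  have h₂ : bracketLoss l u g ≤ (c - g) ^ 2 := by
    rcases hg with rfl | rfl <;> rcases hc with rfl | rfl <;> simp [bracketLoss] <;> linarith
  unfold bracketGain
  nlinarith

lemma bracketLoss_mem_Icc {l u g : ℝ} (hg : g = 0 ∨ g = 1) (hl : 0 ≤ l) (hlu : l ≤ u)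
    (hu : u ≤ 1) : bracketLoss l u g ∈ Set.Icc 0 1 := by
  rcases hg with rfl | rfl <;> simp [bracketLoss] <;> constructor <;> linarith

lemma sq_sub_le_bracketLoss_add {l u g c : ℝ} (hg : g = 0 ∨ g = 1) (hc : c = 0 ∨ c = 1)
    (hl : l ≤ c) (hu : c ≤ u) : (c - g) ^ 2 ≤ bracketLoss l u g + (u - l) := by
  rcases hg with rfl | rfl <;> rcases hc with rfl | rfl <;> simp [bracketLoss] <;> linarith

/-! ### Exponential moments for one observation -/

/-- AM-GM for three factors; it separates the linear noise, the bracket width and the drift without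
any independence. -/
lemma exp_add_add_le (a b c : ℝ) :
    Real.exp (a + b + c) ≤ (Real.exp (3 * a) + Real.exp (3 * b) + Real.exp (3 * c)) / 3 := by
  have key : ∀ x y z : ℝ, 0 ≤ x → 0 ≤ y → 0 ≤ z → x * y * z ≤ (x ^ 3 + y ^ 3 + z ^ 3) / 3 := by
    intro x y z hx hy hz
    nlinarith [mul_nonneg (add_nonneg (add_nonneg hx hy) hz) (sq_nonneg (x - y)),
      mul_nonneg (add_nonneg (add_nonneg hx hy) hz) (sq_nonneg (y - z)),
      mul_nonneg (add_nonneg (add_nonneg hx hy) hz) (sq_nonneg (x - z))]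
  have := key _ _ _ (Real.exp_pos a).le (Real.exp_pos b).le (Real.exp_pos c).le
  rw [Real.exp_add, Real.exp_add]
  simpa [← Real.exp_nat_mul] using this

/-- Convexity of `exp` between `0` and `t`. It keeps the width term linear in `w`, hence controlled
by an `L₁` norm. -/
lemma exp_mul_le_one_add_mul_exp {w : ℝ} (t : ℝ) (hw₀ : 0 ≤ w) (hw₁ : w ≤ 1) :
    Real.exp (w * t) ≤ 1 + w * Real.exp t := by
  have h := convexOn_exp.2 (Set.mem_univ t) (Set.mem_univ 0) hw₀ (sub_nonneg.2 hw₁) (by ring)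
  simp only [smul_eq_mul, mul_zero, add_zero, Real.exp_zero, mul_one] at h
  linarith

lemma exp_bracketGain_le {l u g : ℝ} (s : ℝ) (hlu : l ≤ u) (hw : u - l ≤ 1) :
    Real.exp (bracketGain l u g s / 12) ≤
      (Real.exp ((l - g) / 2 * s) + (1 + (u - l) * (1 + Real.exp (1 / 2 * s))) +
        Real.exp (-bracketLoss l u g / 4)) / 3 := by
  have h := exp_add_add_le ((l - g) / 6 * s) ((u - l) * (max s 0 / 6)) (-bracketLoss l u g / 12)
  have h₂ : Real.exp (max s 0 / 2) ≤ 1 + Real.exp (1 / 2 * s) := by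
    rcases max_cases s 0 with ⟨h, -⟩ | ⟨h, -⟩ <;> rw [h]
    · rw [show s / 2 = 1 / 2 * s by ring]; linarith
    · simp [(Real.exp_pos _).le]
  have h₁ := exp_mul_le_one_add_mul_exp (max s 0 / 2) (sub_nonneg.2 hlu) hw
  have h₃ := mul_le_mul_of_nonneg_left h₂ (sub_nonneg.2 hlu)
  rw [show bracketGain l u g s / 12 =
    (l - g) / 6 * s + (u - l) * (max s 0 / 6) + -bracketLoss l u g / 12 by unfold bracketGain; ring]
  refine h.trans ?_
  rw [show 3 * ((l - g) / 6 * s) = (l - g) / 2 * s by ring,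
    show 3 * ((u - l) * (max s 0 / 6)) = (u - l) * (max s 0 / 2) by ring,
    show 3 * (-bracketLoss l u g / 12) = -bracketLoss l u g / 4 by ring]
  linarith

lemma exp_sq_div_eight_le {a : ℝ} (ha : |a| ≤ 1) :
    Real.exp (a ^ 2 / 8) ≤ 1 + 9 / 64 * |a| := by
  have h₁ : a ^ 2 ≤ |a| := by
    rw [← sq_abs]; nlinarith [abs_nonneg a]
  have h₀ := sq_nonneg a
  have h := Real.abs_exp_sub_one_sub_id_le (x := a ^ 2 / 8) (by
    rw [abs_of_nonneg (by positivity)]; linarith)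
  have := (abs_le.1 h).2
  nlinarith

lemma exp_neg_div_four_le {d : ℝ} (hd₀ : 0 ≤ d) (hd₁ : d ≤ 1) :
    Real.exp (-d / 4) ≤ 1 - 3 / 16 * d := by
  have h := Real.abs_exp_sub_one_sub_id_le (x := -d / 4) (by
    rw [abs_le]; constructor <;> linarith)
  have := (abs_le.1 h).2
  nlinarith

/-- With `d` the loss and `w = u - l`, the variance term costs `9/64 (d + w)` and the drift gains
`3/16 d`. The net `-3/64 d`, divided by three, leaves `-d/64`; the coefficient of `w` stays below
`2`. -/
lemma lintegral_exp_bracketGain_le {l u g : ℝ} (hg : g = 0 ∨ g = 1) (hl : 0 ≤ l) (hlu : l ≤ u)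
    (hu : u ≤ 1) :
    ∫⁻ s, ENNReal.ofReal (Real.exp (bracketGain l u g s / 12)) ∂(gaussianReal 0 1) ≤
      ENNReal.ofReal (1 - bracketLoss l u g / 64 + 2 * (u - l)) := by
  obtain ⟨hd₀, hd₁⟩ := bracketLoss_mem_Icc hg hl hlu hu
  have hmgf : ∀ t : ℝ, ∫ s, Real.exp (t * s) ∂(gaussianReal 0 1) = Real.exp (t ^ 2 / 2) := by
    intro t
    have := congrFun (mgf_id_gaussianReal (μ := 0) (v := 1)) t
    simpa [mgf] using this
  have hint : ∀ t : ℝ, Integrable (fun s ↦ Real.exp (t * s)) (gaussianReal 0 1) := fun t ↦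
    integrable_exp_mul_gaussianReal t
  have hI₁ := hint ((l - g) / 2)
  have hI₂ : Integrable (fun s ↦ 1 + (u - l) * (1 + Real.exp (1 / 2 * s))) (gaussianReal 0 1) :=
    (integrable_const _).add (((integrable_const _).add (hint _)).const_mul _)
  have hI₃ : Integrable (fun _ : ℝ ↦ Real.exp (-bracketLoss l u g / 4)) (gaussianReal 0 1) :=
    integrable_const _
  have hI : Integrable (fun s ↦ (Real.exp ((l - g) / 2 * s) +
      (1 + (u - l) * (1 + Real.exp (1 / 2 * s))) + Real.exp (-bracketLoss l u g / 4)) / 3)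
      (gaussianReal 0 1) := ((hI₁.add hI₂).add hI₃).div_const 3
  refine (lintegral_mono fun s ↦ ENNReal.ofReal_le_ofReal
    (exp_bracketGain_le s hlu (by linarith))).trans ?_
  rw [← ofReal_integral_eq_lintegral_ofReal hI (ae_of_all _ fun s ↦ by
    have : 0 ≤ u - l := by linarith
    simp only [Pi.zero_apply]
    positivity)]
  refine ENNReal.ofReal_le_ofReal ?_
  rw [integral_div, integral_add (by exact hI₁.add hI₂) hI₃, integral_add hI₁ hI₂, integral_add (integrable_const _)
      (by exact ((integrable_const _).add (hint _)).const_mul _), integral_const_mul,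
    integral_add (integrable_const _) (hint _), hmgf, hmgf]
  simp only [integral_const, probReal_univ, smul_eq_mul, one_mul]
  have ha : |l - g| ≤ bracketLoss l u g + (u - l) := by
    rcases hg with rfl | rfl
    · rw [abs_of_nonneg (by linarith)]; simp only [bracketLoss]; linarith
    · rw [abs_of_nonpos (by linarith)]; simp only [bracketLoss]; linarith
  have ha₁ : |l - g| ≤ 1 := by
    rcases hg with rfl | rfl <;> rw [abs_le] <;> constructor <;> linarith
  have e₁ := exp_sq_div_eight_le ha₁
  rw [show (l - g) ^ 2 / 8 = ((l - g) / 2) ^ 2 / 2 by ring] at e₁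
  have e₂ := exp_sq_div_eight_le (a := 1) (by simp)
  rw [show (1 : ℝ) ^ 2 / 8 = (1 / 2) ^ 2 / 2 by norm_num, abs_one] at e₂
  have e₃ := exp_neg_div_four_le hd₀ hd₁
  have e₄ := mul_le_mul_of_nonneg_left e₂ (sub_nonneg.2 hlu)
  linarith

/-! ### Basic inequality for the least squares fit -/

lemma indicator_one_eq_zero_or_one {𝒳 : Type u} (C : Set 𝒳) (x : 𝒳) :
    C.indicator (fun _ ↦ (1 : ℝ)) x = 0 ∨ C.indicator (fun _ ↦ (1 : ℝ)) x = 1 := by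
  by_cases hx : x ∈ C <;> simp [hx]

lemma IsLeastSquaresFit.sum_bracketGain_nonneg {𝒳 : Type u} {Ω : Type v} {n : ℕ}
    {X : Fin n → Ω → 𝒳} {ξ : Fin n → Ω → ℝ} {𝒞 : Set (Set 𝒳)} {C C₀ : Set 𝒳} {ω : Ω}
    (hC : IsLeastSquaresFit 𝒞 (fun i ↦ X i ω) (fun i ↦ response C₀ X ξ i ω) C) (hC₀ : C₀ ∈ 𝒞)
    {b : (𝒳 → ℝ) × (𝒳 → ℝ)} (hb : ∀ i, b.1 (X i ω) ≤ C.indicator (fun _ ↦ (1 : ℝ)) (X i ω) ∧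
      C.indicator (fun _ ↦ (1 : ℝ)) (X i ω) ≤ b.2 (X i ω)) :
    0 ≤ ∑ i, bracketGain (b.1 (X i ω)) (b.2 (X i ω))
      (C₀.indicator (fun _ ↦ (1 : ℝ)) (X i ω)) (ξ i ω) := by
  have h := hC.2 C₀ hC₀
  simp only [leastSquares, response, add_sub_cancel_left] at h
  refine (sub_nonneg.2 h).trans ?_
  rw [← Finset.sum_sub_distrib]
  exact Finset.sum_le_sum fun i _ ↦ sq_sub_sq_le_bracketGain _ (indicator_one_eq_zero_or_one _ _)
    (indicator_one_eq_zero_or_one _ _) (hb i).1 (hb i).2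

/-- An `L₁(P)` bracket of size at most `δ` with measurable end points valued in `[0, 1]`. -/
structure IsUnitBracket {𝒳 : Type u} [MeasurableSpace 𝒳] (P : Measure 𝒳) (δ : ℝ)
    (b : (𝒳 → ℝ) × (𝒳 → ℝ)) : Prop where
  measurable_fst : Measurable b.1
  measurable_snd : Measurable b.2
  nonneg : ∀ x, 0 ≤ b.1 x
  le : ∀ x, b.1 x ≤ b.2 x
  le_one : ∀ x, b.2 x ≤ 1
  integral_le : ∫ x, (b.2 x - b.1 x) ∂P ≤ δ

/-! ### Measurable brackets valued in the unit interval -/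

section Brackets

variable {𝒳 : Type u} [MeasurableSpace 𝒳] {P : Measure 𝒳} {δ : ℝ} {b : (𝒳 → ℝ) × (𝒳 → ℝ)}

lemma IsL1Bracket.exists_isUnitBracket [IsProbabilityMeasure P] (hb : IsL1Bracket P δ b) :
    ∃ b', IsUnitBracket P δ b' ∧ ∀ f : 𝒳 → ℝ, (∀ x, f x ∈ Set.Icc 0 1) → b.1 ≤ f → f ≤ b.2 →
      ∀ᵐ x ∂P, b'.1 x ≤ f x ∧ f x ≤ b'.2 x := by
  obtain ⟨h₁, h₂, hle, hlt⟩ := hb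
  set l := h₁.aestronglyMeasurable.mk b.1
  set u := h₂.aestronglyMeasurable.mk b.2
  have hl : Measurable l := h₁.aestronglyMeasurable.stronglyMeasurable_mk.measurable
  have hu : Measurable u := h₂.aestronglyMeasurable.stronglyMeasurable_mk.measurable
  have hl_eq : b.1 =ᵐ[P] l := h₁.aestronglyMeasurable.ae_eq_mk
  have hu_eq : b.2 =ᵐ[P] u := h₂.aestronglyMeasurable.ae_eq_mk
  -- The outer `max` keeps the ends ordered everywhere, also on the null set where the measurable
  -- versions differ from the original ends.
  refine ⟨(fun x ↦ min (max (l x) 0) 1, fun x ↦ max (min (max (l x) 0) 1) (min (u x) 1)),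
    ⟨by fun_prop, by fun_prop, fun x ↦ by positivity, fun x ↦ le_max_left _ _,
      fun x ↦ max_le (min_le_right _ _) (min_le_right _ _), ?_⟩, fun f hf hlf hfu ↦ ?_⟩
  · refine le_trans ?_ hlt.le
    refine integral_mono_of_nonneg (ae_of_all _ fun x ↦ by simp) (h₂.sub h₁).abs ?_
    filter_upwards [hl_eq, hu_eq] with x hx₁ hx₂
    have := hle x
    simp only [← hx₁, ← hx₂]
    rw [abs_of_nonneg (by linarith)]
    rcases le_total (b.1 x) 0 with h | h <;> rcases le_total (b.2 x) 1 with h' | h' <;>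
      rcases le_total (b.1 x) 1 with h'' | h'' <;> rcases le_total (b.2 x) 0 with h3 | h3 <;>
      simp [max_def, min_def] <;> split_ifs <;> linarith
  · filter_upwards [hl_eq, hu_eq] with x hx₁ hx₂
    obtain ⟨hf₀, hf₁⟩ := hf x
    simp only [← hx₁, ← hx₂]
    exact ⟨(min_le_left _ _).trans (max_le (hlf x) hf₀), le_max_of_le_right (le_min (hfu x) hf₁)⟩

lemma exists_finset_isUnitBracket [IsProbabilityMeasure P] {𝒞 : Set (Set 𝒳)} {H : ℝ}
    (hH : ENNReal.log (setBracketingNumber P δ 𝒞 : ENNReal) ≤ (H : EReal)) :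
    ∃ B : Finset ((𝒳 → ℝ) × (𝒳 → ℝ)), (B.card : ℝ) ≤ Real.exp H ∧
      (∀ b ∈ B, IsUnitBracket P δ b) ∧
      ∀ C ∈ 𝒞, ∃ b ∈ B, ∀ᵐ x ∂P, b.1 x ≤ C.indicator (fun _ ↦ (1 : ℝ)) x ∧
        C.indicator (fun _ ↦ (1 : ℝ)) x ≤ b.2 x := by
  classical
  have hN : (setBracketingNumber P δ 𝒞 : ENNReal) ≤ ENNReal.ofReal (Real.exp H) := by
    have := EReal.expOrderIso.monotone hH
    simpa using this
  obtain ⟨⟨B, hB, hcov⟩, hBeq⟩ : ∃ B : {B : Finset ((𝒳 → ℝ) × (𝒳 → ℝ)) //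
      (∀ b ∈ B, IsL1Bracket P δ b) ∧ ∀ f ∈ ((fun C : Set 𝒳 => C.indicator (fun _ => (1 : ℝ))) '' 𝒞),
        ∃ b ∈ B, b.1 ≤ f ∧ f ≤ b.2}, (B.1.card : ℕ∞) = setBracketingNumber P δ 𝒞 := by
    by_cases hne : Nonempty {B : Finset ((𝒳 → ℝ) × (𝒳 → ℝ)) //
      (∀ b ∈ B, IsL1Bracket P δ b) ∧ ∀ f ∈ ((fun C : Set 𝒳 => C.indicator (fun _ => (1 : ℝ))) '' 𝒞),
        ∃ b ∈ B, b.1 ≤ f ∧ f ≤ b.2}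
    · exact ENat.exists_eq_iInf _
    -- Without a finite cover the infimum is `⊤`, which the finite entropy bound excludes.
    · rw [not_nonempty_iff] at hne
      simp [setBracketingNumber, bracketingNumber, iInf_of_empty] at hN
  choose! F hF hFcov using fun b (hb : b ∈ B) ↦ (hB b hb).exists_isUnitBracket
  refine ⟨B.image F, ?_, ?_, fun C hC ↦ ?_⟩
  · rw [← hBeq] at hN
    have : (B.card : ℝ) ≤ Real.exp H := by
      have := ENNReal.toReal_mono ENNReal.ofReal_ne_top hN
      simpa [Real.exp_nonneg] using this
    exact le_trans (by exact_mod_cast Finset.card_image_le) this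
  · intro b' hb'
    obtain ⟨b, hb, rfl⟩ := Finset.mem_image.1 hb'
    exact hF b hb
  · obtain ⟨b, hb, h₁, h₂⟩ := hcov _ ⟨C, hC, rfl⟩
    refine ⟨F b, Finset.mem_image_of_mem _ hb, hFcov b hb _ (fun x ↦ ?_) h₁ h₂⟩
    by_cases hx : x ∈ C <;> simp [hx]

end Brackets

/-! ### Exponential moments of the sample and the risk bound -/

section Sample

variable {𝒳 : Type u} [MeasurableSpace 𝒳] {P : Measure 𝒳} [IsProbabilityMeasure P]
  {Ω : Type v} [MeasurableSpace Ω] {μ : Measure Ω} [IsProbabilityMeasure μ] {n : ℕ}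
  {X : Fin n → Ω → 𝒳} {ξ : Fin n → Ω → ℝ}

lemma IsDesignWithGaussianNoise.map_pair (h : IsDesignWithGaussianNoise P μ X ξ) :
    μ.map (fun ω i ↦ (X i ω, ξ i ω)) = Measure.pi fun _ ↦ P.prod (gaussianReal 0 1) := by
  have hX : Measurable fun ω i ↦ X i ω := measurable_pi_lambda _ h.measurable_X
  have hξ : Measurable fun ω i ↦ ξ i ω := measurable_pi_lambda _ h.measurable_ξ
  have e₁ := (indepFun_iff_map_prod_eq_prod_map_map hX.aemeasurable hξ.aemeasurable).1
    h.indepFun_X_ξ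
  rw [(iIndepFun_iff_map_fun_eq_pi_map fun i ↦ (h.measurable_X i).aemeasurable).1 h.iIndepFun_X,
    (iIndepFun_iff_map_fun_eq_pi_map fun i ↦ (h.measurable_ξ i).aemeasurable).1
      h.iIndepFun_ξ] at e₁
  simp only [h.law_X, h.law_ξ] at e₁
  have e₂ := (measurePreserving_arrowProdEquivProdArrow 𝒳 ℝ (Fin n) (fun _ ↦ P)
    (fun _ ↦ gaussianReal 0 1)).symm.map_eq
  rw [← e₂, ← e₁, Measure.map_map (MeasurableEquiv.measurable _) (hX.prodMk hξ)]
  rfl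

lemma IsDesignWithGaussianNoise.lintegral_prod (h : IsDesignWithGaussianNoise P μ X ξ)
    {f : 𝒳 × ℝ → ENNReal} (hf : Measurable f) :
    ∫⁻ ω, ∏ i, f (X i ω, ξ i ω) ∂μ = (∫⁻ x, ∫⁻ s, f (x, s) ∂(gaussianReal 0 1) ∂P) ^ n := by
  have hpair : ∀ i, Measurable fun ω ↦ (X i ω, ξ i ω) := fun i ↦
    (h.measurable_X i).prodMk (h.measurable_ξ i)
  have hmeas : Measurable fun ω i ↦ (X i ω, ξ i ω) := measurable_pi_lambda _ hpair
  have hlaw : ∀ i, μ.map (fun ω ↦ (X i ω, ξ i ω)) = P.prod (gaussianReal 0 1) := by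
    intro i
    have := congrArg (Measure.map (Function.eval i)) h.map_pair
    rw [Measure.map_map (measurable_pi_apply i) hmeas, (measurePreserving_eval _ i).map_eq] at this
    exact this
  have hind : iIndepFun (fun i ω ↦ (X i ω, ξ i ω)) μ := by
    rw [iIndepFun_iff_map_fun_eq_pi_map fun i ↦ (hpair i).aemeasurable]
    simp only [hlaw]
    exact h.map_pair
  have := lintegral_prod_eq_prod_lintegral_of_indepFun Finset.univ
    (fun i ω ↦ f (X i ω, ξ i ω)) (hind.comp (fun _ ↦ f) fun _ ↦ hf) fun i ↦ hf.comp (hpair i)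
  rw [this]
  have e : ∀ i, ∫⁻ ω, f (X i ω, ξ i ω) ∂μ = ∫⁻ x, ∫⁻ s, f (x, s) ∂(gaussianReal 0 1) ∂P := by
    intro i
    rw [← MeasureTheory.lintegral_prod f hf.aemeasurable, ← hlaw i, lintegral_map hf (hpair i)]
  simp [e]

lemma IsUnitBracket.integrable {δ : ℝ} {b : (𝒳 → ℝ) × (𝒳 → ℝ)} (hb : IsUnitBracket P δ b) :
    Integrable b.1 P ∧ Integrable b.2 P := by
  refine ⟨.of_bound hb.measurable_fst.aestronglyMeasurable 1 (ae_of_all _ fun x ↦ ?_),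
    .of_bound hb.measurable_snd.aestronglyMeasurable 1 (ae_of_all _ fun x ↦ ?_)⟩ <;>
  · have h₁ := hb.nonneg x
    have h₂ := hb.le x
    have h₃ := hb.le_one x
    rw [Real.norm_eq_abs, abs_le]
    constructor <;> linarith

lemma IsUnitBracket.integrable_bracketLoss {δ : ℝ} {b : (𝒳 → ℝ) × (𝒳 → ℝ)}
    (hb : IsUnitBracket P δ b) {C₀ : Set 𝒳} (hC₀ : MeasurableSet C₀) :
    Integrable (fun x ↦ bracketLoss (b.1 x) (b.2 x) (C₀.indicator (fun _ ↦ (1 : ℝ)) x)) P := by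
  have hg : Measurable (C₀.indicator fun _ ↦ (1 : ℝ)) := measurable_const.indicator hC₀
  have h₁ := hb.measurable_fst
  have h₂ := hb.measurable_snd
  refine .of_bound (C := 1) (by unfold bracketLoss; fun_prop) (ae_of_all _ fun x ↦ ?_)
  obtain ⟨h₀, h₁⟩ := bracketLoss_mem_Icc (indicator_one_eq_zero_or_one C₀ x) (hb.nonneg x)
    (hb.le x) (hb.le_one x)
  rwa [Real.norm_eq_abs, abs_of_nonneg h₀]

lemma IsDesignWithGaussianNoise.lintegral_exp_sum_bracketGain_le
    (h : IsDesignWithGaussianNoise P μ X ξ) {δ : ℝ} {b : (𝒳 → ℝ) × (𝒳 → ℝ)}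
    (hb : IsUnitBracket P δ b) {C₀ : Set 𝒳} (hC₀ : MeasurableSet C₀) :
    ∫⁻ ω, ENNReal.ofReal (Real.exp ((∑ i, bracketGain (b.1 (X i ω)) (b.2 (X i ω))
        (C₀.indicator (fun _ ↦ (1 : ℝ)) (X i ω)) (ξ i ω)) / 12)) ∂μ ≤
      ENNReal.ofReal (Real.exp (n * (2 * δ - (∫ x, bracketLoss (b.1 x) (b.2 x)
        (C₀.indicator (fun _ ↦ (1 : ℝ)) x) ∂P) / 64))) := by
  set g := C₀.indicator fun _ ↦ (1 : ℝ)
  have hg : Measurable g := measurable_const.indicator hC₀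
  have h₁ := hb.measurable_fst
  have h₂ := hb.measurable_snd
  have hf : Measurable fun p : 𝒳 × ℝ ↦
      ENNReal.ofReal (Real.exp (bracketGain (b.1 p.1) (b.2 p.1) (g p.1) p.2 / 12)) := by
    unfold bracketGain bracketLoss
    fun_prop
  have hd := hb.integrable_bracketLoss hC₀
  have hw : Integrable (fun x ↦ b.2 x - b.1 x) P := hb.integrable.2.sub hb.integrable.1
  have hone : Integrable (fun x ↦ 1 - bracketLoss (b.1 x) (b.2 x) (g x) / 64) P :=
    (integrable_const _).sub (hd.div_const _)
  have hle : ∫⁻ x, ∫⁻ s, ENNReal.ofReal (Real.exp (bracketGain (b.1 x) (b.2 x) (g x) s / 12))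
      ∂(gaussianReal 0 1) ∂P ≤
      ENNReal.ofReal (Real.exp (2 * δ - (∫ x, bracketLoss (b.1 x) (b.2 x) (g x) ∂P) / 64)) := by
    refine (lintegral_mono fun x ↦ lintegral_exp_bracketGain_le
      (indicator_one_eq_zero_or_one C₀ x) (hb.nonneg x) (hb.le x) (hb.le_one x)).trans ?_
    have hint : Integrable (fun x ↦ 1 - bracketLoss (b.1 x) (b.2 x) (g x) / 64 +
        2 * (b.2 x - b.1 x)) P := hone.add (hw.const_mul 2)
    rw [← ofReal_integral_eq_lintegral_ofReal hint (ae_of_all _ fun x ↦ by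
      have h₀ := hb.le x
      have h₁ := (bracketLoss_mem_Icc (indicator_one_eq_zero_or_one C₀ x) (hb.nonneg x)
        (hb.le x) (hb.le_one x)).2
      simp only [Pi.zero_apply]
      linarith)]
    refine ENNReal.ofReal_le_ofReal ?_
    rw [integral_add hone (hw.const_mul 2), integral_sub (integrable_const _) (hd.div_const _),
      integral_div, integral_const_mul]
    have := hb.integral_le
    refine le_trans ?_ (Real.add_one_le_exp _)
    simp only [integral_const, probReal_univ, smul_eq_mul, one_mul]
    linarith
  have hprod : ∀ ω, ENNReal.ofReal (Real.exp ((∑ i, bracketGain (b.1 (X i ω)) (b.2 (X i ω))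
      (g (X i ω)) (ξ i ω)) / 12)) = ∏ i, ENNReal.ofReal (Real.exp
        (bracketGain (b.1 (X i ω)) (b.2 (X i ω)) (g (X i ω)) (ξ i ω) / 12)) := by
    intro ω
    rw [Finset.sum_div, Real.exp_sum, ENNReal.ofReal_prod_of_nonneg fun _ _ ↦ Real.exp_nonneg _]
  simp only [hprod]
  rw [h.lintegral_prod hf, Real.exp_nat_mul, ENNReal.ofReal_pow (Real.exp_nonneg _)]
  gcongr

lemma IsUnitBracket.measure_symmDiff_le {δ : ℝ} {b : (𝒳 → ℝ) × (𝒳 → ℝ)}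
    (hb : IsUnitBracket P δ b) {C C₀ : Set 𝒳} (hC : MeasurableSet C) (hC₀ : MeasurableSet C₀)
    (hbC : ∀ᵐ x ∂P, b.1 x ≤ C.indicator (fun _ ↦ (1 : ℝ)) x ∧
      C.indicator (fun _ ↦ (1 : ℝ)) x ≤ b.2 x) :
    P (symmDiff C C₀) ≤ ENNReal.ofReal ((∫ x, bracketLoss (b.1 x) (b.2 x)
        (C₀.indicator (fun _ ↦ (1 : ℝ)) x) ∂P) + δ) := by
  have hCC : MeasurableSet (symmDiff C C₀) := hC.symmDiff hC₀
  have hd := hb.integrable_bracketLoss hC₀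
  have hw : Integrable (fun x ↦ b.2 x - b.1 x) P := hb.integrable.2.sub hb.integrable.1
  rw [← ofReal_measureReal, ← integral_indicator_one hCC]
  refine ENNReal.ofReal_le_ofReal (le_trans ?_ (add_le_add_right hb.integral_le _))
  rw [← integral_add hd hw]
  refine integral_mono_ae ((integrable_const 1).indicator hCC) (hd.add hw) ?_
  filter_upwards [hbC] with x hx
  refine le_trans (le_of_eq ?_) (sq_sub_le_bracketLoss_add (indicator_one_eq_zero_or_one C₀ x)
    (indicator_one_eq_zero_or_one C x) hx.1 hx.2)
  by_cases h₁ : x ∈ C <;> by_cases h₂ : x ∈ C₀ <;> simp [h₁, h₂, Set.mem_symmDiff]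

/-- Risk bound for least squares over a class covered by at most `exp (n H)` brackets of
size `δ`. -/
lemma IsDesignWithGaussianNoise.lintegral_measure_symmDiff_le
    (h : IsDesignWithGaussianNoise P μ X ξ) (hn : 1 ≤ n) {𝒞 : Set (Set 𝒳)} (h𝒞 : 𝒞.Countable)
    (hmeas : ∀ C ∈ 𝒞, MeasurableSet C) {δ H : ℝ} (hδ : 0 ≤ δ) (hH : 0 ≤ H)
    (hent : ENNReal.log (setBracketingNumber P δ 𝒞 : ENNReal) ≤ ((n * H : ℝ) : EReal))
    {C₀ : Set 𝒳} (hC₀ : C₀ ∈ 𝒞) {Chat : Ω → Set 𝒳}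
    (hfit : ∀ᵐ ω ∂μ, IsLeastSquaresFit 𝒞 (fun i ↦ X i ω)
      (fun i ↦ response C₀ X ξ i ω) (Chat ω)) :
    ∫⁻ ω, P (symmDiff (Chat ω) C₀) ∂μ ≤ ENNReal.ofReal (64 * H + 129 * δ + 64 / n) := by
  obtain ⟨B, hcard, hB, hcov⟩ := exists_finset_isUnitBracket hent
  choose! β hβB hβ using hcov
  have hn₀ : (0 : ℝ) < n := by exact_mod_cast hn
  set S : (𝒳 → ℝ) × (𝒳 → ℝ) → Ω → ℝ := fun b ω ↦ ∑ i, bracketGain (b.1 (X i ω)) (b.2 (X i ω))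
    (C₀.indicator (fun _ ↦ (1 : ℝ)) (X i ω)) (ξ i ω) with hS
  set D : (𝒳 → ℝ) × (𝒳 → ℝ) → ℝ := fun b ↦ ∫ x, bracketLoss (b.1 x) (b.2 x)
    (C₀.indicator (fun _ ↦ (1 : ℝ)) x) ∂P with hD
  -- The brackets hold only `P`-a.e.; countability of `𝒞` gives one null set for all `C`, so the
  -- data-dependent `Chat ω` can be substituted.
  have hgood : ∀ᵐ ω ∂μ, ∀ C ∈ 𝒞, ∀ i, (β C).1 (X i ω) ≤ C.indicator (fun _ ↦ (1 : ℝ)) (X i ω) ∧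
      C.indicator (fun _ ↦ (1 : ℝ)) (X i ω) ≤ (β C).2 (X i ω) := by
    refine (ae_ball_iff h𝒞).2 fun C hC ↦ ae_all_iff.2 fun i ↦ ?_
    have := hβ C hC
    rw [← h.law_X i] at this
    exact ae_of_ae_map (h.measurable_X i).aemeasurable this
  -- `2 n δ` cancels the moment bound and `n H` pays for the number of brackets.
  set M : ℝ := n * (H + 2 * δ) with hM
  -- Bounding by a sum over all of `B` removes the random choice of bracket and any need for
  -- measurability of `Chat`. It rests on `t ≤ exp t * exp (S b ω / 12)` with `t = n * D b / 64 -
  -- M`, valid as `S b ω ≥ 0`.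
  have hbound : ∀ᵐ ω ∂μ, P (symmDiff (Chat ω) C₀) ≤ ENNReal.ofReal (64 / n * M + δ) +
      ∑ b ∈ B, ENNReal.ofReal (64 / n * Real.exp (n * D b / 64 - M)) *
        ENNReal.ofReal (Real.exp (S b ω / 12)) := by
    filter_upwards [hfit, hgood] with ω hω hg
    set b := β (Chat ω)
    have hSb : 0 ≤ S b ω := hω.sum_bracketGain_nonneg hC₀ (hg _ hω.1)
    refine ((hB b (hβB _ hω.1)).measure_symmDiff_le (hmeas _ hω.1) (hmeas _ hC₀)
      (hβ _ hω.1)).trans ?_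
    refine le_trans ?_ (add_le_add_right (Finset.single_le_sum (f := fun b ↦
      ENNReal.ofReal (64 / n * Real.exp (n * D b / 64 - M)) *
        ENNReal.ofReal (Real.exp (S b ω / 12))) (fun _ _ ↦ zero_le) (hβB _ hω.1)) _)
    rw [← ENNReal.ofReal_mul (by positivity), ← ENNReal.ofReal_add (by positivity) (by positivity)]
    refine ENNReal.ofReal_le_ofReal ?_
    have e₁ := Real.add_one_le_exp (n * D b / 64 - M)
    have e₂ : 1 ≤ Real.exp (S b ω / 12) := Real.one_le_exp (by positivity)
    have e₃ : n * D b / 64 - M ≤ Real.exp (n * D b / 64 - M) * Real.exp (S b ω / 12) :=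
      le_trans (by linarith) (le_mul_of_one_le_right (Real.exp_nonneg _) e₂)
    have e₄ := mul_le_mul_of_nonneg_left e₃ (show 0 ≤ 64 / (n : ℝ) by positivity)
    have e₅ : 64 / (n : ℝ) * (n * D b / 64 - M) = D b - 64 / n * M := by field_simp
    rw [e₅] at e₄
    change D b + δ ≤ _
    rw [mul_assoc]
    linarith
  have hmeasS : ∀ b ∈ B, Measurable fun ω ↦ ENNReal.ofReal (Real.exp (S b ω / 12)) := by
    intro b hb
    have h₁ := (hB b hb).measurable_fst
    have h₂ := (hB b hb).measurable_snd
    have h₃ : Measurable (C₀.indicator fun _ ↦ (1 : ℝ)) :=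
      measurable_const.indicator (hmeas _ hC₀)
    have h₄ := h.measurable_X
    have h₅ := h.measurable_ξ
    simp only [hS, bracketGain, bracketLoss]
    fun_prop
  have hterm : ∀ b ∈ B, ∫⁻ ω, ENNReal.ofReal (64 / n * Real.exp (n * D b / 64 - M)) *
      ENNReal.ofReal (Real.exp (S b ω / 12)) ∂μ ≤
        ENNReal.ofReal (64 / n * Real.exp (-(n * H))) := by
    intro b hb
    rw [lintegral_const_mul _ (hmeasS b hb)]
    refine (mul_le_mul_right (h.lintegral_exp_sum_bracketGain_le (hB b hb) (hmeas _ hC₀)) _).trans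
      ?_
    rw [← ENNReal.ofReal_mul (by positivity), mul_assoc, ← Real.exp_add]
    refine (congrArg (fun t ↦ ENNReal.ofReal (64 / n * Real.exp t)) ?_).le
    simp only [hM, hD]
    ring
  refine (lintegral_mono_ae hbound).trans ?_
  rw [lintegral_add_left measurable_const, lintegral_finsetSum _ fun b hb ↦
    (hmeasS b hb).const_mul _]
  simp only [lintegral_const, measure_univ, mul_one]
  refine (add_le_add_right (Finset.sum_le_sum hterm) _).trans ?_
  rw [Finset.sum_const, nsmul_eq_mul, ← ENNReal.ofReal_natCast,
    ← ENNReal.ofReal_mul (by positivity), ← ENNReal.ofReal_add (by positivity) (by positivity)]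
  refine ENNReal.ofReal_le_ofReal ?_
  have e₁ : (B.card : ℝ) * (64 / n * Real.exp (-(n * H))) ≤ 64 / n := by
    have := mul_le_mul_of_nonneg_right hcard
      (show 0 ≤ 64 / (n : ℝ) * Real.exp (-(n * H)) by positivity)
    refine this.trans (le_of_eq ?_)
    rw [Real.exp_neg]
    field_simp
  have e₂ : 64 / (n : ℝ) * M = 64 * (H + 2 * δ) := by rw [hM]; field_simp
  rw [e₂]
  linarith

end Sample

end ImageEstimation

end
-- Choice of scale and the rate
/-- For every `C₀ ∈ 𝒞`, `Chat C₀` is a least squares estimator over `𝒞` computed from the sample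
`(Xᵢ, 1_{C₀}(Xᵢ) + ξᵢ)`. The constant `K` depends on `α` and `L` only. -/
theorem theorem3 (α L : ℝ) (hα : 0 < α) (hα1 : α ≠ 1) (hL : 0 < L) :
    ∃ K : ℝ, 0 < K ∧
      ∀ (𝒳 : Type u) [MeasurableSpace 𝒳] (P : Measure 𝒳) [IsProbabilityMeasure P]
        (𝒞 : Set (Set 𝒳)),
        𝒞.Countable →
        (∀ C ∈ 𝒞, MeasurableSet C) →
        (∀ ε : ℝ, 0 < ε → ε ≤ 1 →
          ENNReal.log (ImageEstimation.setBracketingNumber P ε 𝒞 : ENNReal)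
            ≤ ((L * ε ^ (-α) : ℝ) : EReal)) →
        ∀ (n : ℕ), 1 ≤ n →
        ∀ (Ω : Type v) [MeasurableSpace Ω] (μ : Measure Ω) [IsProbabilityMeasure μ]
          (X : Fin n → Ω → 𝒳) (ξ : Fin n → Ω → ℝ),
          ImageEstimation.IsDesignWithGaussianNoise P μ X ξ →
        ∀ Chat : Set 𝒳 → Ω → Set 𝒳,
          (∀ C₀ ∈ 𝒞, ∀ᵐ ω ∂μ,
            ImageEstimation.IsLeastSquaresFit 𝒞 (fun i => X i ω)
              (fun i => ImageEstimation.response C₀ X ξ i ω) (Chat C₀ ω)) →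
          ⨆ C₀ ∈ 𝒞, ∫⁻ ω, P (symmDiff (Chat C₀ ω) C₀) ∂μ
            ≤ ENNReal.ofReal (K * (n : ℝ) ^ (-1 / (α + 1))) := by
  -- `193 = 129 + 64`: the risk bound with `H = L δ` and `1 / n ≤ δ`.
  refine ⟨64 * L + 193, by positivity, ?_⟩
  intro 𝒳 _ P _ 𝒞 h𝒞 hmeas hent n hn Ω _ μ _ X ξ h Chat hfit
  have hn₁ : (1 : ℝ) ≤ n := by exact_mod_cast hn
  have hn₀ : (0 : ℝ) < n := by linarith
  set δ : ℝ := (n : ℝ) ^ (-1 / (α + 1)) with hδ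
  have hδ₀ : 0 < δ := Real.rpow_pos_of_pos hn₀ _
  have hδ₁ : δ ≤ 1 := Real.rpow_le_one_of_one_le_of_nonpos hn₁
    (div_nonpos_of_nonpos_of_nonneg (by norm_num) (by linarith))
  have hrate : L * δ ^ (-α) = n * (L * δ) := by
    have : δ ^ (-α) = n * δ := by
      rw [hδ, ← Real.rpow_mul hn₀.le, mul_comm (n : ℝ), ← Real.rpow_add_one hn₀.ne']
      congr 1
      field_simp
      ring
    rw [this]
    ring
  have hinv : 1 / (n : ℝ) ≤ δ := by
    rw [one_div, ← Real.rpow_neg_one, hδ]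
    refine Real.rpow_le_rpow_of_exponent_le hn₁ ?_
    rw [le_div_iff₀ (by linarith)]
    linarith
  refine iSup₂_le fun C₀ hC₀ ↦ ?_
  have key := h.lintegral_measure_symmDiff_le hn h𝒞 hmeas hδ₀.le (H := L * δ) (by positivity)
    (by rw [← hrate]; exact hent δ hδ₀ hδ₁) hC₀ (hfit C₀ hC₀)
  refine key.trans (ENNReal.ofReal_le_ofReal ?_)
  rw [show 64 / (n : ℝ) = 64 * (1 / n) by ring]
  linarith
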